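/- Schottky's theorem (several variables). Let $M > 0$ and $r \in (0,1)$ be given. Then there exists a constant $C > 0$, depending only on $M$ and $r$, such that for every natural number $n$ the following holds. Write $B(0,\rho) = \{z \in \mathbb{C}^n : |z| < \rho\}$, where $|z| = (|z_1|^2 + \dots + |z_n|^2)^{1/2}$ is the Euclidean norm. If $f : B(0,1) \to \mathbb{C}$ is holomorphic, omits the values $0$ and $1$, and satisfies $|f(0)| < M$, then $|f(z)| < C$ for all $z \in B(0,r)$. -/

import Mathlib

/-!
Restricting `f` to the complex line through `0` and `z` reduces the claim to one variable
(`schottky_unitDisc`), with a constant that does not depend on the dimension.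

In the unit disc the argument is the classical one of Landau and König. A holomorphic function on a
disc omitting `1` and `-1` has the form `cos (π F)` with `F` holomorphic, and `F` can be chosen with
`‖F 0‖` controlled by the value at `0` (`exists_cos_pi_mul_lift`). If `f` omits `0` and `1`, write
`2 f - 1 = cos (π F)`; then `F` omits all integers, hence can be lifted again, `F = cos (π g)`.
Now `g` omits every `p` for which `cos (π p)` is an integer, and these points come within distance
`2` of each point of the plane (`exists_cos_pi_mul_eq_int_near`). So the image of `g` contains no
disc of radius `2`, and Bloch's theorem, in the form of a bound for the derivative of a function
whose image contains no large disc (`norm_deriv_mul_le_of_forall_not_ball_subset`), bounds `g'` on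
`ball 0 r`. This bounds `g`, hence `F`, hence `f`.

No lower bound on `‖f 0‖` or `‖f 0 - 1‖` enters: `g 0` is controlled through `‖f 0‖` alone because
`cos (π v) = w` always has a solution with `‖v‖ ≤ 1 + ‖w‖`.
-/

open Metric Set

/-! ### Holomorphic logarithms and inverse cosines on a disc -/

theorem exists_holomorphic_log_of_ne_zero {f : ℂ → ℂ} {c : ℂ} {R : ℝ}
    (hf : DifferentiableOn ℂ f (ball c R)) (h0 : ∀ z ∈ ball c R, f z ≠ 0) :
    ∃ g : ℂ → ℂ, DifferentiableOn ℂ g (ball c R) ∧ ∀ z ∈ ball c R, Complex.exp (g z) = f z := by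
  rcases le_or_gt R 0 with hR | hR
  · exact ⟨0, differentiableOn_const 0, by simp [ball_eq_empty.2 hR]⟩
  have hc : c ∈ ball c R := mem_ball_self hR
  obtain ⟨g, hgc, hg⟩ :=
    ((hf.deriv isOpen_ball).div hf h0).isExactOn_ball.with_val_at c (Complex.log (f c))
  have hgd : DifferentiableOn ℂ g (ball c R) := fun z hz ↦
    (hg z hz).differentiableAt.differentiableWithinAt
  refine ⟨g, hgd, fun z hz ↦ ?_⟩
  have hquot : f z * Complex.exp (-g z) = f c * Complex.exp (-g c) := by
    refine isOpen_ball.is_const_of_deriv_eq_zero (f := fun w ↦ f w * Complex.exp (-g w))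
      (convex_ball c R).isPreconnected (hf.mul hgd.neg.cexp) (fun w hw ↦ ?_) hz hc
    have hfw := (hf.differentiableAt (isOpen_ball.mem_nhds hw)).hasDerivAt
    refine (hfw.mul (hg w hw).neg.cexp).deriv.trans ?_
    have hfw0 := h0 w hw
    simp only [Pi.div_apply, Pi.zero_apply, Pi.neg_apply]
    field_simp
    ring
  rw [hgc, Complex.exp_neg, Complex.exp_neg, Complex.exp_log (h0 c hc),
    mul_inv_cancel₀ (h0 c hc)] at hquot
  exact (eq_of_div_eq_one (by rwa [div_eq_mul_inv])).symm

theorem abs_im_le_norm_cos_pi_mul (w : ℂ) : |w.im| ≤ ‖Complex.cos (Real.pi * w)‖ := by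
  set x := Real.pi * w.re
  set y := Real.pi * w.im with hy
  have hw : (Real.pi * w : ℂ) = x + y * Complex.I := by
    apply Complex.ext <;> simp [x, y]
  have hsq : ‖Complex.cos (Real.pi * w)‖ ^ 2 = Real.cos x ^ 2 + Real.sinh y ^ 2 := by
    rw [hw, Complex.cos_add_mul_I, ← Complex.ofReal_cos, ← Complex.ofReal_sin,
      ← Complex.ofReal_cosh, ← Complex.ofReal_sinh, ← Complex.normSq_eq_norm_sq,
      Complex.normSq_apply]
    simp only [Complex.sub_re, Complex.sub_im, Complex.mul_re, Complex.mul_im, Complex.ofReal_re,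
      Complex.ofReal_im, Complex.I_re, Complex.I_im]
    nlinarith [Real.sin_sq_add_cos_sq x, Real.cosh_sq y]
  have hsinh : |y| ≤ |Real.sinh y| := by
    rw [Real.abs_sinh]
    exact Real.self_le_sinh_iff.2 (abs_nonneg y)
  calc |w.im| ≤ |y| := by
        rw [hy, abs_mul, abs_of_pos Real.pi_pos]
        nlinarith [Real.pi_gt_three, abs_nonneg w.im]
    _ ≤ |Real.sinh y| := hsinh
    _ ≤ ‖Complex.cos (Real.pi * w)‖ :=
        abs_le_of_sq_le_sq (hsq ▸ le_add_of_nonneg_left (sq_nonneg _)) (norm_nonneg _)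

/-- The two omitted values `1`, `-1` are the branch points of the inverse cosine, so that it can be
lifted through `h` on a disc. The period `2` of `cos (π ·)` allows the lift to be normalized by
`|re (F c)| ≤ 1`, whence the bound on `‖F c‖`. -/
theorem exists_cos_pi_mul_lift {h : ℂ → ℂ} {c : ℂ} {R : ℝ} (hd : DifferentiableOn ℂ h (ball c R))
    (h1 : ∀ z ∈ ball c R, h z ≠ 1) (h2 : ∀ z ∈ ball c R, h z ≠ -1) (hR : 0 < R) :
    ∃ F : ℂ → ℂ, DifferentiableOn ℂ F (ball c R) ∧
      (∀ z ∈ ball c R, Complex.cos (Real.pi * F z) = h z) ∧ ‖F c‖ ≤ 1 + ‖h c‖ := by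
  have hpi : (Real.pi : ℂ) ≠ 0 := by exact_mod_cast Real.pi_ne_zero
  obtain ⟨L, hLd, hL⟩ := exists_holomorphic_log_of_ne_zero (f := fun z ↦ 1 - h z ^ 2)
    ((differentiableOn_const 1).sub (hd.pow 2)) (fun z hz h0 ↦ by
      rcases eq_or_eq_neg_of_sq_eq_sq (h z) 1 (by linear_combination -h0) with h | h
      exacts [h1 z hz h, h2 z hz h])
  -- With `k ^ 2 = 1 - h ^ 2`, the function `h + k i` is zero-free, and `h = cos θ` as soon as
  -- `h + k i = exp (θ i)`.
  set k : ℂ → ℂ := fun z ↦ Complex.exp (L z / 2)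
  have hk : ∀ z ∈ ball c R, k z ^ 2 = 1 - h z ^ 2 := fun z hz ↦ by
    rw [← hL z hz, ← Complex.exp_nat_mul]
    push_cast
    congr 1
    ring
  have hfac : ∀ z ∈ ball c R, (h z + k z * Complex.I) * (h z - k z * Complex.I) = 1 :=
      fun z hz ↦ by linear_combination hk z hz - k z ^ 2 * Complex.I_sq
  obtain ⟨E, hEd, hE⟩ := exists_holomorphic_log_of_ne_zero
    (hd.add ((hLd.div_const 2).cexp.mul_const Complex.I))
    (fun z hz ↦ left_ne_zero_of_mul_eq_one (hfac z hz))
  set n : ℤ := round ((E c / (Real.pi * Complex.I)).re / 2)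
  set F : ℂ → ℂ := fun z ↦ E z / (Real.pi * Complex.I) - 2 * n with hF
  have hcos : ∀ z ∈ ball c R, Complex.cos (Real.pi * F z) = h z := fun z hz ↦ by
    have hper : (Real.pi * F z : ℂ) =
        Real.pi * (E z / (Real.pi * Complex.I)) - n * (2 * Real.pi) := by
      simp only [hF]; ring
    have hEz : Real.pi * (E z / (Real.pi * Complex.I)) * Complex.I = E z := by
      field_simp [Complex.I_ne_zero]
    have hinv : Complex.exp (-E z) = h z - k z * Complex.I := by
      rw [Complex.exp_neg, hE z hz]
      exact inv_eq_of_mul_eq_one_right (hfac z hz)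
    rw [hper, Complex.cos_sub_int_mul_two_pi, Complex.cos, neg_mul, hEz, hinv, hE z hz]
    simp only [Pi.add_apply, k]
    ring
  refine ⟨F, (hEd.div_const _).sub_const _, hcos, ?_⟩
  have hre : |(F c).re| ≤ 1 := by
    have := abs_sub_round ((E c / (Real.pi * Complex.I)).re / 2)
    have hFre : (F c).re = 2 * ((E c / (Real.pi * Complex.I)).re / 2 - n) := by
      simp only [hF, Complex.sub_re, Complex.mul_re, Complex.re_ofNat, Complex.im_ofNat,
        Complex.intCast_re, Complex.intCast_im]
      ring
    rw [hFre, abs_mul, abs_two]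
    linarith
  have him := abs_im_le_norm_cos_pi_mul (F c)
  rw [hcos c (mem_ball_self hR)] at him
  exact (Complex.norm_le_abs_re_add_abs_im _).trans (add_le_add hre him)

/-- The points `2 m ± i arcosh n / π` with `m` an integer and `n` a positive integer, at which
`cos (π ·)` takes the value `n`, form a `2`-net in the plane. -/
theorem exists_cos_pi_mul_eq_int_near (w : ℂ) :
    ∃ p ∈ ball w 2, ∃ k : ℤ, Complex.cos (Real.pi * p) = k := by
  set y := |w.im|
  have hy : 0 ≤ y := abs_nonneg _
  have hpy : 0 ≤ Real.pi * y := by positivity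
  set n : ℕ := ⌊Real.cosh (Real.pi * y)⌋₊
  have hn1 : 1 ≤ n := Nat.le_floor (by simp)
  have hn1' : (1 : ℝ) ≤ n := by exact_mod_cast hn1
  have hnle : (n : ℝ) ≤ Real.cosh (Real.pi * y) := Nat.floor_le (by positivity)
  have hltn : Real.cosh (Real.pi * y) < n + 1 := Nat.lt_floor_add_one _
  set L := Real.arcosh n
  have hL0 : 0 ≤ L := Real.arcosh_nonneg hn1'
  have hcL : Real.cosh L = n := Real.cosh_arcosh hn1'
  have hLy : L ≤ Real.pi * y := by
    rw [← Real.arcosh_cosh hpy]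
    exact (Real.arcosh_le_arcosh (by linarith) (by positivity)).2 hnle
  -- The factor `2` in `cosh (π y) < n + 1 ≤ 2 n = 2 cosh L` costs at most `log 4 < π` in the
  -- argument.
  have hyL : Real.pi * y < L + Real.pi := by
    rw [← Real.exp_lt_exp, Real.exp_add]
    have h1 : Real.exp (Real.pi * y) ≤ 2 * Real.cosh (Real.pi * y) := by
      rw [Real.cosh_eq]; linarith [Real.exp_pos (-(Real.pi * y))]
    have h2 : Real.cosh L ≤ Real.exp L := by
      rw [Real.cosh_eq]; linarith [Real.exp_le_exp.2 (show -L ≤ L by linarith)]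
    nlinarith [Real.add_one_le_exp Real.pi, Real.pi_gt_three, Real.exp_pos L]
  obtain ⟨t, hct, ht⟩ : ∃ t : ℝ, Real.cosh (Real.pi * t) = n ∧ |t - w.im| < 1 := by
    have hpL : Real.pi * (L / Real.pi) = L := by field_simp
    have h3 : L / Real.pi ≤ y := by rw [div_le_iff₀ Real.pi_pos]; linarith
    have h4 : y < L / Real.pi + 1 := by
      by_contra! hcon
      nlinarith [Real.pi_pos]
    rcases abs_cases w.im with ⟨h, -⟩ | ⟨h, -⟩
    · refine ⟨L / Real.pi, by rw [hpL, hcL], ?_⟩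
      rw [abs_lt]; constructor <;> linarith
    · refine ⟨-(L / Real.pi), by rw [mul_neg, Real.cosh_neg, hpL, hcL], ?_⟩
      rw [abs_lt]; constructor <;> linarith
  set m : ℤ := round (w.re / 2)
  refine ⟨2 * m + t * Complex.I, ?_, n, ?_⟩
  · rw [mem_ball, dist_eq_norm_sub]
    refine (Complex.norm_le_abs_re_add_abs_im _).trans_lt ?_
    have hm := abs_sub_round (w.re / 2)
    have e1 : (2 * (m : ℂ) + t * Complex.I - w).re = -(2 * (w.re / 2 - m)) := by
      simp; ring
    have e2 : (2 * (m : ℂ) + t * Complex.I - w).im = t - w.im := by simp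
    rw [e1, e2, abs_neg, abs_mul, abs_two]
    linarith
  · have e : (Real.pi * (2 * m + t * Complex.I) : ℂ)
        = ((Real.pi * t : ℝ) : ℂ) * Complex.I + m * (2 * Real.pi) := by
      push_cast; ring
    rw [e, Complex.cos_add_int_mul_two_pi, Complex.cos_mul_I, ← Complex.ofReal_cosh, hct]
    simp

/-! ### Bloch's theorem -/

/-- A quantitative open mapping theorem: by the Schwarz lemma applied to `deriv g`, the function `g`
is close to its linearization at `a` on the ball of radius `R / 6`. -/
theorem ball_subset_image_of_norm_deriv_le_two_mul {g : ℂ → ℂ} {a : ℂ} {R : ℝ} (hR : 0 < R)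
    (hg : DifferentiableOn ℂ g (ball a R)) (ha : deriv g a ≠ 0)
    (hbound : ∀ z ∈ ball a R, ‖deriv g z‖ ≤ 2 * ‖deriv g a‖) :
    ball (g a) (‖deriv g a‖ * R / 24) ⊆ g '' ball a R := by
  set d := ‖deriv g a‖
  have hd : 0 < d := norm_pos_iff.2 ha
  have hsub : closedBall a (R / 6) ⊆ ball a R := closedBall_subset_ball (by linarith)
  have haR : a ∈ ball a R := mem_ball_self hR
  have hdiff : ∀ z ∈ ball a R, DifferentiableAt ℂ g z := fun z hz ↦
    hg.differentiableAt (isOpen_ball.mem_nhds hz)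
  have hvar : ∀ z ∈ closedBall a (R / 6), ‖deriv g z - deriv g a‖ ≤ d / 2 := fun z hz ↦ by
    have hmaps : MapsTo (deriv g) (ball a R) (closedBall (deriv g a) (3 * d)) := fun w hw ↦ by
      rw [mem_closedBall, dist_eq_norm_sub]
      linarith [norm_sub_le (deriv g w) (deriv g a), hbound w hw]
    have := Complex.dist_le_div_mul_dist_of_mapsTo_ball (hg.deriv isOpen_ball) hmaps (hsub hz)
    rw [dist_eq_norm_sub] at this
    calc _ ≤ 3 * d / R * dist z a := this
      _ ≤ 3 * d / R * (R / 6) := by gcongr; exact hz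
      _ = d / 2 := by field_simp; ring
  have hlow : ∀ z ∈ sphere a (R / 6), d * R / 12 ≤ ‖g z - g a‖ := fun z hz ↦ by
    have hmv : ‖(g z - deriv g a * z) - (g a - deriv g a * a)‖ ≤ d / 2 * ‖z - a‖ := by
      refine (convex_closedBall a (R / 6)).norm_image_sub_le_of_norm_hasDerivWithin_le
        (f := fun w ↦ g w - deriv g a * w) (f' := fun w ↦ deriv g w - deriv g a)
        (fun w hw ↦ ?_) hvar (mem_closedBall_self (by positivity)) (sphere_subset_closedBall hz)
      exact ((hdiff w (hsub hw)).hasDerivAt.sub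
        (by simpa using (hasDerivAt_id w).const_mul (deriv g a))).hasDerivWithinAt
    have hza : ‖z - a‖ = R / 6 := by rwa [← dist_eq_norm_sub]
    have htri : ‖deriv g a * (z - a)‖ ≤ ‖g z - g a‖ +
        ‖(g z - deriv g a * z) - (g a - deriv g a * a)‖ := by
      refine le_trans (le_of_eq ?_) (norm_sub_le _ _)
      congr 1; ring
    rw [norm_mul, hza] at htri
    rw [hza] at hmv
    change d * (R / 6) ≤ _ at htri
    linarith
  have hnc : ∃ᶠ z in nhds a, g z ≠ g a := by
    intro hev
    have : g =ᶠ[nhds a] fun _ ↦ g a := hev.mono fun z hz ↦ not_not.1 hz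
    exact ha (by rw [this.deriv_eq, deriv_const])
  have hcl : DiffContOnCl ℂ g (ball a (R / 6)) :=
    DifferentiableOn.diffContOnCl (hg.mono ((closure_ball_subset_closedBall).trans hsub))
  have := hcl.ball_subset_image_closedBall (by positivity) hlow hnc
  rw [show d * R / 12 / 2 = d * R / 24 by ring] at this
  exact this.trans (image_mono hsub)

/-- **Bloch's theorem**, as a bound on the derivative of a function on the unit disc whose image
contains no disc of radius `ρ`. The previous lemma applies at a point `a` where
`‖deriv g a‖ * (s - ‖a‖)` is maximal, on the ball of radius `(s - ‖a‖) / 2`. -/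
theorem norm_deriv_mul_le_of_forall_not_ball_subset {g : ℂ → ℂ} {ρ s : ℝ} (hs : s < 1)
    (hρ : 0 ≤ ρ)
    (hg : DifferentiableOn ℂ g (ball 0 1)) (hno : ∀ w, ¬ ball w ρ ⊆ g '' ball 0 1)
    {z : ℂ} (hz : ‖z‖ ≤ s) : ‖deriv g z‖ * (s - ‖z‖) ≤ 48 * ρ := by
  have hsub : closedBall (0 : ℂ) s ⊆ ball 0 1 := closedBall_subset_ball hs
  have hcont : ContinuousOn (fun w ↦ ‖deriv g w‖ * (s - ‖w‖)) (closedBall 0 s) :=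
    (((hg.deriv isOpen_ball).continuousOn.mono hsub).norm).mul (by fun_prop)
  obtain ⟨a, ha, hmax⟩ := (isCompact_closedBall (0 : ℂ) s).exists_isMaxOn
    ⟨z, mem_closedBall_zero_iff.2 hz⟩ hcont
  refine (hmax (mem_closedBall_zero_iff.2 hz)).trans ?_
  simp only
  rw [mem_closedBall_zero_iff] at ha
  by_contra! hlt
  have hpos : 0 < ‖deriv g a‖ * (s - ‖a‖) := lt_of_le_of_lt (by positivity) hlt
  have hda : 0 < ‖deriv g a‖ := pos_of_mul_pos_left hpos (by linarith)
  have hsa : 0 < s - ‖a‖ := pos_of_mul_pos_right hpos hda.le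
  have hball : ∀ w ∈ ball a ((s - ‖a‖) / 2), (s - ‖a‖) / 2 ≤ s - ‖w‖ := fun w hw ↦ by
    rw [mem_ball, dist_eq_norm_sub] at hw
    linarith [norm_sub_norm_le w a]
  have hin : ball a ((s - ‖a‖) / 2) ⊆ closedBall 0 s := fun w hw ↦ by
    rw [mem_closedBall_zero_iff]
    linarith [hball w hw]
  have key := ball_subset_image_of_norm_deriv_le_two_mul (half_pos hsa)
    (hg.mono (hin.trans hsub)) (norm_pos_iff.1 hda) (fun w hw ↦ by
      have h1 : ‖deriv g w‖ * (s - ‖w‖) ≤ ‖deriv g a‖ * (s - ‖a‖) := hmax (hin hw)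
      have h2 := mul_le_mul_of_nonneg_left (hball w hw) (norm_nonneg (deriv g w))
      by_contra! h3
      nlinarith)
  exact hno (g a) ((ball_subset_ball (by linarith)).trans
    (key.trans (image_mono (hin.trans hsub))))

/-! ### Schottky's theorem -/

theorem norm_cos_le_exp_norm (w : ℂ) : ‖Complex.cos w‖ ≤ Real.exp ‖w‖ := by
  have h1 := Complex.norm_exp_le_exp_norm (w * Complex.I)
  have h2 := Complex.norm_exp_le_exp_norm (-w * Complex.I)
  simp only [norm_mul, norm_neg, Complex.norm_I, mul_one] at h1 h2
  rw [Complex.cos, norm_div, Complex.norm_ofNat]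
  linarith [norm_add_le (Complex.exp (w * Complex.I)) (Complex.exp (-w * Complex.I))]

theorem cos_pi_mul_int_eq_one_or (k : ℤ) :
    Complex.cos (Real.pi * k) = 1 ∨ Complex.cos (Real.pi * k) = -1 := by
  apply Complex.sin_eq_zero_iff_cos_eq.1
  rw [mul_comm, Complex.sin_int_mul_pi]

/-- **Schottky's theorem** in one variable. -/
theorem schottky_unitDisc (M : ℝ) {r : ℝ} (hr : r < 1) :
    ∃ C : ℝ, 0 < C ∧ ∀ f : ℂ → ℂ, DifferentiableOn ℂ f (ball 0 1) →
      (∀ z ∈ ball (0 : ℂ) 1, f z ≠ 0 ∧ f z ≠ 1) → ‖f 0‖ < M → ∀ z ∈ ball (0 : ℂ) r, ‖f z‖ < C := by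
  set s := (1 + r) / 2
  -- Here `3 + 2 * M` bounds `‖g 0‖`, and `96 / (s - r)` is the bound on `‖deriv g‖` over
  -- `ball 0 r`.
  set A := 3 + 2 * M + 96 / (s - r)
  refine ⟨1 + Real.exp (Real.pi * Real.exp (Real.pi * A)), by positivity,
    fun f hf h01 hM z hz ↦ ?_⟩
  have h0 : (0 : ℂ) ∈ ball (0 : ℂ) 1 := mem_ball_self one_pos
  have hsr : r < s := by simp only [s]; linarith
  have hs1 : s < 1 := by simp only [s]; linarith
  obtain ⟨F, hFd, hF, hF0⟩ := exists_cos_pi_mul_lift (h := fun z ↦ 2 * f z - 1)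
    ((hf.const_mul 2).sub_const 1)
    (fun z hz h ↦ (h01 z hz).2 (by linear_combination h / 2))
    (fun z hz h ↦ (h01 z hz).1 (by linear_combination h / 2)) one_pos
  have hFint : ∀ w ∈ ball (0 : ℂ) 1, ∀ k : ℤ, F w ≠ k := fun w hw k hk ↦ by
    have hFw := hF w hw
    rw [hk] at hFw
    rcases cos_pi_mul_int_eq_one_or k with h | h
    · exact (h01 w hw).2 (by linear_combination (h - hFw) / 2)
    · exact (h01 w hw).1 (by linear_combination (h - hFw) / 2)
  obtain ⟨g, hgd, hg, hg0⟩ := exists_cos_pi_mul_lift hFd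
    (fun w hw ↦ by simpa using hFint w hw 1) (fun w hw ↦ by simpa using hFint w hw (-1)) one_pos
  have hno : ∀ w, ¬ ball w 2 ⊆ g '' ball 0 1 := fun w hsub ↦ by
    obtain ⟨p, hp, k, hk⟩ := exists_cos_pi_mul_eq_int_near w
    obtain ⟨v, hv, rfl⟩ := hsub hp
    exact hFint v hv k (by rw [← hg v hv, hk])
  have hr0 : 0 < r := pos_of_mem_ball hz
  have hderiv : ∀ w ∈ ball (0 : ℂ) r, ‖deriv g w‖ ≤ 96 / (s - r) := fun w hw ↦ by
    rw [mem_ball_zero_iff] at hw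
    have := norm_deriv_mul_le_of_forall_not_ball_subset hs1 zero_le_two hgd hno (hw.trans hsr).le
    rw [le_div_iff₀ (by linarith)]
    refine (mul_le_mul_of_nonneg_left (by linarith) (norm_nonneg _)).trans (this.trans_eq ?_)
    norm_num
  have hzr : ‖z‖ < r := mem_ball_zero_iff.1 hz
  have hz1 : z ∈ ball (0 : ℂ) 1 := ball_subset_ball hr.le hz
  have hgA : ‖g z‖ ≤ A := by
    have hmv := (convex_ball (0 : ℂ) r).norm_image_sub_le_of_norm_deriv_le
      (fun w hw ↦ hgd.differentiableAt (isOpen_ball.mem_nhds (ball_subset_ball hr.le hw)))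
      hderiv (mem_ball_self hr0) hz
    rw [sub_zero] at hmv
    have hK : 0 ≤ 96 / (s - r) := div_nonneg (by norm_num) (by linarith)
    have h2f : ‖2 * f 0 - 1‖ ≤ 2 * ‖f 0‖ + 1 := by
      simpa using norm_sub_le (2 * f 0) 1
    have := norm_sub_norm_le (g z) (g 0)
    have := mul_le_of_le_one_right hK (hzr.trans hr).le
    simp only [A]
    linarith
  have hFz : ‖F z‖ ≤ Real.exp (Real.pi * A) := by
    rw [← hg z hz1]
    refine (norm_cos_le_exp_norm _).trans (Real.exp_le_exp.2 ?_)
    rw [norm_mul, Complex.norm_real, Real.norm_of_nonneg Real.pi_pos.le]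
    gcongr
  have hfz : ‖2 * f z - 1‖ ≤ Real.exp (Real.pi * Real.exp (Real.pi * A)) := by
    rw [← hF z hz1]
    refine (norm_cos_le_exp_norm _).trans (Real.exp_le_exp.2 ?_)
    rw [norm_mul, Complex.norm_real, Real.norm_of_nonneg Real.pi_pos.le]
    gcongr
  have htri : 2 * ‖f z‖ ≤ ‖2 * f z - 1‖ + 1 := by
    simpa using norm_add_le (2 * f z - 1) 1
  linarith [Real.exp_pos (Real.pi * Real.exp (Real.pi * A))]

theorem mainTheorem5 (M : ℝ) (hM : 0 < M) (r : ℝ) (hr : r ∈ Set.Ioo (0 : ℝ) 1) :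
    ∃ C : ℝ, 0 < C ∧
      ∀ (n : ℕ) (f : EuclideanSpace ℂ (Fin n) → ℂ),
        DifferentiableOn ℂ f (Metric.ball 0 1) →
        (∀ z ∈ Metric.ball (0 : EuclideanSpace ℂ (Fin n)) 1, f z ≠ 0 ∧ f z ≠ 1) →
        ‖f 0‖ < M →
        ∀ z ∈ Metric.ball (0 : EuclideanSpace ℂ (Fin n)) r, ‖f z‖ < C := by
  obtain ⟨C, hC, hCf⟩ := schottky_unitDisc M hr.2
  refine ⟨C, hC, fun n f hf h01 hf0 z hz ↦ ?_⟩
  -- The direction `u` is taken to be `0` if `z = 0`, which covers dimension `0` as well.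
  obtain ⟨u, hu, hzu⟩ : ∃ u : EuclideanSpace ℂ (Fin n), ‖u‖ ≤ 1 ∧ (‖z‖ : ℂ) • u = z := by
    rcases eq_or_ne z 0 with rfl | hz0
    · exact ⟨0, by simp, by simp⟩
    · have hz' : (‖z‖ : ℂ) ≠ 0 := by simpa using hz0
      refine ⟨(‖z‖ : ℂ)⁻¹ • z, ?_, smul_inv_smul₀ hz' z⟩
      rw [norm_smul, norm_inv, Complex.norm_real, norm_norm,
        inv_mul_cancel₀ (norm_ne_zero_iff.2 hz0)]
  have hmaps : MapsTo (fun w : ℂ ↦ w • u) (ball 0 1) (ball 0 1) := fun w hw ↦ by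
    rw [mem_ball_zero_iff] at hw ⊢
    rw [norm_smul]
    exact (mul_le_of_le_one_right (norm_nonneg w) hu).trans_lt hw
  have := hCf (fun w ↦ f (w • u)) (hf.comp (by fun_prop) hmaps) (fun w hw ↦ h01 _ (hmaps hw))
    (by simpa using hf0) (‖z‖ : ℂ) (by simpa using hz)
  simpa [hzu] using this
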